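/- Proposition 3.4. Let $1<p,q<\infty$. Write $\ell_q^n$ for $\mathbb R^n$ with the $\ell_q$-norm and let $X=\bigoplus_{\ell_p}\ell_q^n$ be the $\ell_p$-direct sum of the spaces $\ell_q^n$, $n=1,2,3,\dots$, that is, the space of sequences $(x_n)_{n\ge 1}$ with $x_n\in\ell_q^n$ and $\|(x_n)\|=\left(\sum_n\|x_n\|_{\ell_q^n}^p\right)^{1/p}<\infty$. Let $\pi_n:\ell_q\to\ell_q^n$ be the projection onto the first $n$ coordinates and let $i_n:\ell_q^n\to X$ be the inclusion as the $n$-th summand. For a real number $r>0$, a real-valued function $f$ on a real Banach space $E$ is called uniformly $H^r$-smooth if $f$ is of class $C^k$ on $E$, where $k$ is the largest integer strictly less than $r$, and there is a constant $M>0$ such that $\|f^{(k)}(y)-f^{(k)}(z)\|\le M\|y-z\|^{r-k}$ for all $y,z\in E$ (here $f^{(0)}=f$). Let $r>0$, let $F:X\to\mathbb R$ be uniformly $H^r$-smooth, and for each $n\ge 1$ define $F_n:\ell_q\to\mathbb R$ by $F_n=F\circ i_n\circ\pi_n$. Then there are a subsequence $(F_{n_j})_j$ of $(F_n)_n$ and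 a uniformly $H^r$-smooth function $F^*:\ell_q\to\mathbb R$ such that $F_{n_j}(x)\to F^*(x)$ for every $x\in\ell_q$. -/

import Mathlib

open Filter Topology
open scoped ENNReal

noncomputable section

/-- A real-valued function `f` on a real normed space is uniformly `H^r`-smooth (`r > 0`) if it is
`C^n` on the whole space, where `n` is the largest integer strictly less than `r`, and its `n`-th
derivative is globally `(r - n)`-Hölder, with a single constant. -/
def UniformlyHSmooth {E : Type*} [NormedAddCommGroup E] [NormedSpace ℝ E]
    (r : ℝ) (f : E → ℝ) : Prop :=
  ∃ n : ℕ, IsGreatest {m : ℕ | (m : ℝ) < r} n ∧ ContDiff ℝ n f ∧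
    ∃ M : ℝ, 0 < M ∧ ∀ y z : E,
      ‖iteratedFDeriv ℝ n f y - iteratedFDeriv ℝ n f z‖ ≤ M * ‖y - z‖ ^ (r - n)

/-- The real sequence space `ℓ_q`. -/
abbrev SeqLq (q : ℝ≥0∞) : Type := lp (fun _ : ℕ => ℝ) q

/-- The finite-dimensional space `ℓ_q^n`, that is `ℝ^n` with the `ℓ_q`-norm. -/
abbrev FinLq (q : ℝ≥0∞) (n : ℕ+) : Type := PiLp q (fun _ : Fin (n : ℕ) => ℝ)

/-- The `ℓ_p`-direct sum of the spaces `ℓ_q^n`, `n = 1, 2, 3, …`. -/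
abbrev SumLpLq (p q : ℝ≥0∞) [Fact (1 ≤ q)] : Type := lp (fun n : ℕ+ => FinLq q n) p

/-- The projection `π_n` of `ℓ_q` onto `ℓ_q^n`: the first `n` coordinates. -/
def projLq (q : ℝ≥0∞) (n : ℕ+) (x : SeqLq q) : FinLq q n :=
  WithLp.toLp q (fun i : Fin (n : ℕ) => x (i : ℕ))

/-- The inclusion `i_n` of `ℓ_q^n` as the `n`-th summand of the `ℓ_p`-sum. -/
def inclLq (p q : ℝ≥0∞) [Fact (1 ≤ q)] (n : ℕ+) (v : FinLq q n) : SumLpLq p q :=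
  lp.single (E := fun m : ℕ+ => FinLq q m) p n v

end

/-! Each `i_n ∘ π_n` is a linear contraction, so the `F_n` inherit the Hölder constant of `F`, and
their derivatives at 0 are bounded by those of `F`. Integrating down from order `k`, all derivatives
of order at most `k` are bounded on balls and equicontinuous, uniformly in `n`. As `ℓ_q` is
separable, Arzelà–Ascoli yields a pointwise convergent subsequence. The limit is smooth although
derivatives need not converge in norm: along an ultrafilter they converge pointwise as multilinear
forms, and the uniform Taylor remainder and Hölder estimates survive such limits
(`contDiff_and_holder_of_tendsto`). -/

section EquiSmooth

variable {ι E : Type*} [NormedAddCommGroup E] [NormedSpace ℝ E]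

/-- The mean value inequality for iterated derivatives on balls. -/
theorem norm_iteratedFDeriv_sub_le {f : E → ℝ} {k j : ℕ} (hf : ContDiff ℝ k f) (hj : j < k)
    {C R : ℝ} (hC : ∀ x ∈ Metric.closedBall (0 : E) R, ‖iteratedFDeriv ℝ (j + 1) f x‖ ≤ C)
    {x y : E} (hx : x ∈ Metric.closedBall (0 : E) R) (hy : y ∈ Metric.closedBall (0 : E) R) :
    ‖iteratedFDeriv ℝ j f y - iteratedFDeriv ℝ j f x‖ ≤ C * ‖y - x‖ := by
  refine (convex_closedBall (0 : E) R).norm_image_sub_le_of_norm_fderiv_le (𝕜 := ℝ)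
    (fun z _ => hf.differentiable_iteratedFDeriv (by exact_mod_cast hj) z) (fun z hz => ?_) hx hy
  rw [norm_fderiv_iteratedFDeriv]
  exact hC z hz

/-- The first-order Taylor remainder of an iterated derivative is controlled by the oscillation of
the next derivative. -/
theorem norm_iteratedFDeriv_sub_sub_curryLeft_le {f : E → ℝ} {k j : ℕ} (hf : ContDiff ℝ k f)
    (hj : j < k) {x : E} {ε δ : ℝ}
    (h : ∀ z ∈ Metric.ball x δ, ‖iteratedFDeriv ℝ (j + 1) f z - iteratedFDeriv ℝ (j + 1) f x‖ ≤ ε)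
    {y : E} (hy : y ∈ Metric.ball x δ) :
    ‖iteratedFDeriv ℝ j f y - iteratedFDeriv ℝ j f x
      - (iteratedFDeriv ℝ (j + 1) f x).curryLeft (y - x)‖ ≤ ε * ‖y - x‖ := by
  have hδ : 0 < δ := Metric.pos_of_mem_ball hy
  have hs : ContDiff ℝ k f ↔ HasFTaylorSeriesUpTo k f (ftaylorSeries ℝ f) :=
    contDiff_iff_ftaylorSeries
  refine (convex_ball x δ).norm_image_sub_le_of_norm_hasFDerivWithin_le' (𝕜 := ℝ)
    (f := iteratedFDeriv ℝ j f) (f' := fun z => (iteratedFDeriv ℝ (j + 1) f z).curryLeft)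
    (fun z _ => ((hs.1 hf).fderiv j (by exact_mod_cast hj) z).hasFDerivWithinAt)
    (fun z hz => ?_) (Metric.mem_ball_self hδ) hy
  refine le_trans (le_of_eq ?_) (h z hz)
  exact (continuousMultilinearCurryLeftEquiv ℝ (fun _ : Fin (j + 1) => E) ℝ).norm_map
    (iteratedFDeriv ℝ (j + 1) f z - iteratedFDeriv ℝ (j + 1) f x)

/-- A family of `C^k` functions whose `k`-th derivatives are Hölder with common constants and whose
derivatives of order at most `k` are bounded at the origin. -/
structure EquiHolderSmooth (f : ι → E → ℝ) (k : ℕ) (α M B : ℝ) : Prop where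
  contDiff : ∀ i, ContDiff ℝ k (f i)
  exponent_pos : 0 < α
  const_pos : 0 < M
  holder : ∀ i y z,
    ‖iteratedFDeriv ℝ k (f i) y - iteratedFDeriv ℝ k (f i) z‖ ≤ M * ‖y - z‖ ^ α
  bound_zero : ∀ i, ∀ j ≤ k, ‖iteratedFDeriv ℝ j (f i) 0‖ ≤ B

namespace EquiHolderSmooth

variable {f : ι → E → ℝ} {k : ℕ} {α M B : ℝ}

/-- Descending induction on the order: the Hölder condition handles order `k`, and the mean value
inequality from the origin passes from `j + 1` to `j`. -/
theorem exists_bound (h : EquiHolderSmooth f k α M B) {R : ℝ} (hR : 0 ≤ R) {j : ℕ} (hj : j ≤ k) :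
    ∃ C, ∀ i, ∀ x ∈ Metric.closedBall (0 : E) R, ‖iteratedFDeriv ℝ j (f i) x‖ ≤ C := by
  induction hj using Nat.decreasingInduction with
  | self =>
    refine ⟨B + M * R ^ α, fun i x hx => ?_⟩
    have h1 := norm_le_norm_add_norm_sub (iteratedFDeriv ℝ k (f i) 0) (iteratedFDeriv ℝ k (f i) x)
    have h2 := h.holder i x 0
    rw [norm_sub_rev, sub_zero] at h2
    have h3 : ‖x‖ ^ α ≤ R ^ α :=
      Real.rpow_le_rpow (norm_nonneg x) (mem_closedBall_zero_iff.1 hx) h.exponent_pos.le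
    have h4 := h.bound_zero i k le_rfl
    have h5 := mul_le_mul_of_nonneg_left h3 h.const_pos.le
    linarith
  | of_succ j hj ih =>
    obtain ⟨C, hC⟩ := ih
    refine ⟨B + C * R, fun i x hx => ?_⟩
    have h0 : (0 : E) ∈ Metric.closedBall (0 : E) R := Metric.mem_closedBall_self hR
    have h1 := norm_le_norm_add_norm_sub (iteratedFDeriv ℝ j (f i) 0) (iteratedFDeriv ℝ j (f i) x)
    have h2 := norm_iteratedFDeriv_sub_le (h.contDiff i) hj (hC i) h0 hx
    rw [norm_sub_rev, sub_zero] at h2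
    have h4 := h.bound_zero i j hj.le
    have hC0 : 0 ≤ C := (norm_nonneg _).trans (hC i 0 h0)
    have h5 := mul_le_mul_of_nonneg_left (mem_closedBall_zero_iff.1 hx) hC0
    linarith

theorem exists_pointwise_bound (h : EquiHolderSmooth f k α M B) (x : E) {j : ℕ} (hj : j ≤ k) :
    ∃ C, ∀ i, ‖iteratedFDeriv ℝ j (f i) x‖ ≤ C := by
  obtain ⟨C, hC⟩ := h.exists_bound (norm_nonneg x) hj
  exact ⟨C, fun i => hC i x (by simp)⟩

theorem equicontinuousAt (h : EquiHolderSmooth f k α M B) {j : ℕ} (hj : j ≤ k) (x : E) {ε : ℝ}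
    (hε : 0 < ε) :
    ∃ δ > 0, ∀ i, ∀ y ∈ Metric.ball x δ,
      ‖iteratedFDeriv ℝ j (f i) y - iteratedFDeriv ℝ j (f i) x‖ ≤ ε := by
  -- A common modulus of continuity suffices: Hölder at order `k`, Lipschitz on bounded sets below
  -- it.
  suffices H : ∃ g : ℝ → ℝ, Tendsto g (𝓝 0) (𝓝 0) ∧ ∀ i, ∀ y ∈ Metric.ball x 1,
      ‖iteratedFDeriv ℝ j (f i) y - iteratedFDeriv ℝ j (f i) x‖ ≤ g ‖y - x‖ by
    obtain ⟨g, hg, hgf⟩ := H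
    obtain ⟨δ, hδ, hgδ⟩ := Metric.eventually_nhds_iff.1 (hg.eventually (gt_mem_nhds hε))
    refine ⟨min δ 1, by positivity, fun i y hy => ?_⟩
    refine (hgf i y (Metric.ball_subset_ball (min_le_right _ _) hy)).trans (hgδ ?_).le
    rw [dist_zero_right, norm_norm, ← dist_eq_norm]
    exact (Metric.mem_ball.1 hy).trans_le (min_le_left _ _)
  rcases hj.eq_or_lt with rfl | hlt
  · refine ⟨fun t => M * t ^ α, ?_, fun i y _ => h.holder i y x⟩
    have := ((Real.continuous_rpow_const h.exponent_pos.le).const_mul M).tendsto 0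
    simpa [Real.zero_rpow h.exponent_pos.ne'] using this
  · obtain ⟨C, hC⟩ := h.exists_bound (R := ‖x‖ + 1) (by positivity) (Nat.succ_le_of_lt hlt)
    refine ⟨fun t => C * t, ?_, fun i y hy => ?_⟩
    · simpa using (continuous_const_mul C).tendsto 0
    · refine norm_iteratedFDeriv_sub_le (h.contDiff i) hlt (hC i) ?_ ?_
      · simp
      · rw [mem_closedBall_zero_iff]
        have h1 := norm_le_norm_add_norm_sub x y
        rw [norm_sub_rev, ← dist_eq_norm] at h1
        linarith [Metric.mem_ball.1 hy]

theorem apply_equicontinuousAt (h : EquiHolderSmooth f k α M B) (x : E) {ε : ℝ} (hε : 0 < ε) :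
    ∃ δ > 0, ∀ i, ∀ y ∈ Metric.ball x δ, |f i y - f i x| ≤ ε := by
  obtain ⟨δ, hδ, H⟩ := h.equicontinuousAt (Nat.zero_le k) x hε
  refine ⟨δ, hδ, fun i y hy => ?_⟩
  have h1 := (iteratedFDeriv ℝ 0 (f i) y - iteratedFDeriv ℝ 0 (f i) x).le_opNorm 0
  simp only [sub_apply, iteratedFDeriv_zero_apply, Finset.univ_eq_empty,
    Finset.prod_empty, mul_one, Real.norm_eq_abs] at h1
  exact h1.trans (H i y hy)

/-- Arzelà–Ascoli: pointwise convergence of a subsequence on a separable space. -/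
theorem exists_subseq_tendsto [TopologicalSpace.SeparableSpace E] {f : ℕ → E → ℝ}
    (h : EquiHolderSmooth f k α M B) :
    ∃ (φ : ℕ → ℕ) (G : E → ℝ), StrictMono φ ∧
      ∀ x, Tendsto (fun j => f (φ j) x) atTop (𝓝 (G x)) := by
  have hd := TopologicalSpace.denseRange_denseSeq E
  set d := TopologicalSpace.denseSeq E
  choose C hC using fun m => h.exists_pointwise_bound (d m) (Nat.zero_le k)
  have hmem : ∀ n, (fun m => f n (d m)) ∈ Set.univ.pi fun m => Metric.closedBall (0 : ℝ) (C m) := by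
    intro n m _
    rw [mem_closedBall_zero_iff]
    simpa using hC m n
  -- Compactness of a countable product of intervals replaces the diagonal argument.
  obtain ⟨a, -, φ, hφ, ha⟩ :=
    (isCompact_univ_pi fun m => isCompact_closedBall (0 : ℝ) (C m)).tendsto_subseq hmem
  rw [tendsto_pi_nhds] at ha
  have hlim : ∀ x, ∃ g, Tendsto (fun j => f (φ j) x) atTop (𝓝 g) := by
    intro x
    refine cauchySeq_tendsto_of_complete (Metric.cauchySeq_iff'.2 fun ε hε => ?_)
    -- Three errors of at most `ε / 4` are added, through the dense point `d m`.
    obtain ⟨δ, hδ, H⟩ := h.apply_equicontinuousAt x (ε := ε / 4) (by positivity)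
    obtain ⟨m, hm⟩ := hd.exists_dist_lt x hδ
    rw [dist_comm] at hm
    obtain ⟨N, hN⟩ := Metric.cauchySeq_iff'.1 (ha m).cauchySeq (ε / 4) (by positivity)
    refine ⟨N, fun n hn => ?_⟩
    have h1 := abs_le.1 (H (φ n) (d m) hm)
    have h2 := abs_le.1 (H (φ N) (d m) hm)
    have h3 := abs_lt.1 (hN n hn)
    simp only [Function.comp_apply] at h3
    rw [Real.dist_eq, abs_lt]
    constructor <;> linarith [h1.1, h1.2, h2.1, h2.2, h3.1, h3.2]
  choose G hG using hlim
  exact ⟨φ, G, hφ, hG⟩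

end EquiHolderSmooth

/-- Bounded families of multilinear forms converge pointwise along ultrafilters. -/
theorem ContinuousMultilinearMap.exists_tendsto_ultrafilter {j : ℕ} (U : Ultrafilter ι)
    {a : ι → ContinuousMultilinearMap ℝ (fun _ : Fin j => E) ℝ} {C : ℝ} (ha : ∀ i, ‖a i‖ ≤ C) :
    ∃ A : ContinuousMultilinearMap ℝ (fun _ : Fin j => E) ℝ,
      ∀ v, Tendsto (fun i => a i v) U (𝓝 (A v)) := by
  have hb : ∀ i v, ‖a i v‖ ≤ C * ∏ l, ‖v l‖ := fun i v => (a i).le_of_opNorm_le (ha i) v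
  have hlim : ∀ v, ∃ g, Tendsto (fun i => a i v) U (𝓝 g) := by
    intro v
    obtain ⟨g, -, hg⟩ := (isCompact_closedBall (0 : ℝ) (C * ∏ l, ‖v l‖)).ultrafilter_le_nhds
      (U.map fun i => a i v) (le_principal_iff.2 (by
        rw [Ultrafilter.mem_coe, Ultrafilter.mem_map]
        exact univ_mem' fun i => mem_closedBall_zero_iff.2 (hb i v)))
    exact ⟨g, hg⟩
  choose A hA using hlim
  refine ⟨MultilinearMap.mkContinuous (E := fun _ : Fin j => E) (G := ℝ)
    { toFun := A
      map_update_add' := fun {inst} v l x y => ?_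
      map_update_smul' := fun {inst} v l c x => ?_ } C fun v => ?_, hA⟩
  · refine tendsto_nhds_unique (hA _) (((hA _).add (hA _)).congr fun i => ?_)
    exact ((a i).map_update_add v l x y).symm
  · refine tendsto_nhds_unique (hA _) (((hA _).const_smul c).congr fun i => ?_)
    exact ((a i).map_update_smul v l c x).symm
  · exact le_of_tendsto (hA v).norm (Eventually.of_forall fun i => hb i v)

/-- Closed balls of forms are closed under pointwise limits; this carries every uniform estimate to
the limit. -/
theorem ContinuousMultilinearMap.norm_le_of_tendsto {j : ℕ} {U : Filter ι} [U.NeBot]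
    {a : ι → ContinuousMultilinearMap ℝ (fun _ : Fin j => E) ℝ} {C : ℝ} (ha : ∀ i, ‖a i‖ ≤ C)
    {A : ContinuousMultilinearMap ℝ (fun _ : Fin j => E) ℝ}
    (hA : ∀ v, Tendsto (fun i => a i v) U (𝓝 (A v))) : ‖A‖ ≤ C := by
  obtain ⟨i⟩ := U.nonempty_of_neBot
  refine A.opNorm_le_bound ((norm_nonneg _).trans (ha i)) fun v => ?_
  exact le_of_tendsto (hA v).norm (Eventually.of_forall fun i => (a i).le_of_opNorm_le (ha i) v)

namespace EquiHolderSmooth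

variable {f : ι → E → ℝ} {k : ℕ} {α M B : ℝ}

/-- Pointwise limits of a family with uniform Hölder smoothness inherit that smoothness. -/
theorem contDiff_and_holder_of_tendsto (h : EquiHolderSmooth f k α M B) {l : Filter ι} [l.NeBot]
    {G : E → ℝ} (hG : ∀ x, Tendsto (fun i => f i x) l (𝓝 (G x))) :
    ContDiff ℝ k G ∧
      ∀ y z, ‖iteratedFDeriv ℝ k G y - iteratedFDeriv ℝ k G z‖ ≤ M * ‖y - z‖ ^ α := by
  -- An ultrafilter gives limits of the derivatives at all points and orders at once, without
  -- further subsequences.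
  set U := Ultrafilter.of l
  have hUl : (U : Filter ι) ≤ l := Ultrafilter.of_le l
  have hex : ∀ (x : E) (j : ℕ), ∃ A : ContinuousMultilinearMap ℝ (fun _ : Fin j => E) ℝ,
      j ≤ k → ∀ v, Tendsto (fun i => iteratedFDeriv ℝ j (f i) x v) U (𝓝 (A v)) := by
    intro x j
    by_cases hj : j ≤ k
    · obtain ⟨C, hC⟩ := h.exists_pointwise_bound x hj
      obtain ⟨A, hA⟩ := ContinuousMultilinearMap.exists_tendsto_ultrafilter U hC
      exact ⟨A, fun _ => hA⟩
    · exact ⟨0, fun h => absurd h hj⟩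
  choose A hA using hex
  have hsub : ∀ {j : ℕ}, j ≤ k → ∀ {y z : E} {C : ℝ},
      (∀ i, ‖iteratedFDeriv ℝ j (f i) y - iteratedFDeriv ℝ j (f i) z‖ ≤ C) →
      ‖A y j - A z j‖ ≤ C := fun hj y z C hC =>
    ContinuousMultilinearMap.norm_le_of_tendsto (U := (U : Filter ι)) hC
      fun v => (hA y _ hj v).sub (hA z _ hj v)
  have hT : HasFTaylorSeriesUpTo k G A := by
    refine ⟨fun x => ?_, fun j hj x => ?_, fun j hj => ?_⟩
    · refine tendsto_nhds_unique (hA x 0 (Nat.zero_le k) 0) ?_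
      simpa using (hG x).mono_left hUl
    · have hj : j < k := by exact_mod_cast hj
      rw [hasFDerivAt_iff_isLittleO, Asymptotics.isLittleO_iff]
      intro ε hε
      obtain ⟨δ, hδ, H⟩ := h.equicontinuousAt (Nat.succ_le_of_lt hj) x hε
      filter_upwards [Metric.ball_mem_nhds x hδ] with y hy
      -- The remainder bound holds with the same `δ` for all `i`, so it passes to the limit and
      -- gives differentiability.
      refine ContinuousMultilinearMap.norm_le_of_tendsto (U := (U : Filter ι))
        (fun i => norm_iteratedFDeriv_sub_sub_curryLeft_le (h.contDiff i) hj (H i) hy) fun v => ?_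
      exact ((hA y j hj.le v).sub (hA x j hj.le v)).sub (hA x (j + 1) hj (Fin.cons (y - x) v))
    · have hj : j ≤ k := by exact_mod_cast hj
      rw [Metric.continuous_iff']
      intro x ε hε
      obtain ⟨δ, hδ, H⟩ := h.equicontinuousAt hj x (half_pos hε)
      filter_upwards [Metric.ball_mem_nhds x hδ] with y hy
      rw [dist_eq_norm]
      exact (hsub hj fun i => H i y hy).trans_lt (half_lt_self hε)
  refine ⟨hT.contDiff, fun y z => ?_⟩
  rw [← hT.eq_iteratedFDeriv le_rfl, ← hT.eq_iteratedFDeriv le_rfl]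
  exact hsub le_rfl fun i => h.holder i y z

end EquiHolderSmooth

/-- Composition of one Hölder smooth function with linear contractions. -/
theorem equiHolderSmooth_comp {E' : Type*} [NormedAddCommGroup E'] [NormedSpace ℝ E']
    {F : E' → ℝ} {k : ℕ} {α M : ℝ} (hF : ContDiff ℝ k F) (hα : 0 < α) (hM : 0 < M)
    (hFM : ∀ y z, ‖iteratedFDeriv ℝ k F y - iteratedFDeriv ℝ k F z‖ ≤ M * ‖y - z‖ ^ α)
    {T : ι → E →L[ℝ] E'} (hT : ∀ i, ‖T i‖ ≤ 1) :
    EquiHolderSmooth (fun i => F ∘ T i) k α M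
      (∑ j ∈ Finset.range (k + 1), ‖iteratedFDeriv ℝ j F 0‖) := by
  have hcomp : ∀ i {j : ℕ} (a : ContinuousMultilinearMap ℝ (fun _ : Fin j => E') ℝ),
      ‖a.compContinuousLinearMap fun _ => T i‖ ≤ ‖a‖ := by
    intro i j a
    refine (a.norm_compContinuousLinearMap_le _).trans
      (mul_le_of_le_one_right (norm_nonneg _) ?_)
    exact Finset.prod_le_one (fun _ _ => norm_nonneg _) fun _ _ => hT i
  refine ⟨fun i => hF.comp (T i).contDiff, hα, hM, fun i y z => ?_, fun i j hj => ?_⟩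
  · rw [(T i).iteratedFDeriv_comp_right hF y le_rfl, (T i).iteratedFDeriv_comp_right hF z le_rfl]
    refine (hcomp i (iteratedFDeriv ℝ k F (T i y) - iteratedFDeriv ℝ k F (T i z))).trans
      ((hFM _ _).trans ?_)
    rw [← map_sub]
    refine mul_le_mul_of_nonneg_left (Real.rpow_le_rpow (norm_nonneg _) ?_ hα.le) hM.le
    exact (T i).le_of_opNorm_le_of_le (hT i) le_rfl |>.trans_eq (one_mul _)
  -- Since `T i 0 = 0`, only derivatives of `F` at 0 enter; the sum dominates each of them.
  · rw [(T i).iteratedFDeriv_comp_right hF 0 (by exact_mod_cast hj), map_zero]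
    exact (hcomp i _).trans (Finset.single_le_sum (f := fun j => ‖iteratedFDeriv ℝ j F 0‖)
      (fun _ _ => norm_nonneg _) (Finset.mem_range.2 (Nat.lt_succ_of_le hj)))

end EquiSmooth

section SequenceSpaces

/-- For finite `q` the unit vectors, a countable set, have dense span. -/
theorem separableSpace_seqLq (q : ℝ≥0∞) [Fact (1 ≤ q)] (hq : q ≠ ∞) :
    TopologicalSpace.SeparableSpace (SeqLq q) := by
  have hs : TopologicalSpace.IsSeparable
      (Submodule.span ℝ (Set.range fun n : ℕ => (lp.single q n (1 : ℝ) : SeqLq q)) :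
        Set (SeqLq q)) :=
    (Set.countable_range _).isSeparable.span
  refine TopologicalSpace.isSeparable_univ_iff.1 (hs.closure.mono fun x _ => ?_)
  refine mem_closure_of_tendsto (lp.hasSum_single hq x) (Eventually.of_forall fun s => ?_)
  refine Submodule.sum_mem _ fun n _ => ?_
  have : (lp.single q n (x n) : SeqLq q) = x n • lp.single q n (1 : ℝ) := by
    rw [← lp.single_smul, smul_eq_mul, mul_one]
  rw [this]
  exact Submodule.smul_mem _ _ (Submodule.subset_span ⟨n, rfl⟩)

theorem norm_projLq_le (q : ℝ≥0∞) [Fact (1 ≤ q)] (hq : q ≠ ∞) (n : ℕ+) (x : SeqLq q) :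
    ‖projLq q n x‖ ≤ ‖x‖ := by
  have hq0 : 0 < q.toReal := ENNReal.toReal_pos (zero_lt_one.trans_le Fact.out).ne' hq
  rw [PiLp.norm_eq_sum hq0, one_div,
    Real.rpow_inv_le_iff_of_pos (Finset.sum_nonneg fun _ _ => by positivity) (norm_nonneg _) hq0]
  refine le_trans (le_of_eq ?_) (lp.sum_rpow_le_norm_rpow hq0 x (Finset.range n))
  exact Fin.sum_univ_eq_sum_range (fun i => ‖x i‖ ^ q.toReal) n

/-- The composition `i_n ∘ π_n` as a continuous linear map. -/
noncomputable def inclProjLq (p q : ℝ≥0∞) [Fact (1 ≤ p)] [Fact (1 ≤ q)] (hq : q ≠ ∞) (n : ℕ+) :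
    SeqLq q →L[ℝ] SumLpLq p q :=
  LinearMap.mkContinuous
    { toFun := fun x => inclLq p q n (projLq q n x)
      map_add' := fun x y => lp.single_add (E := fun m : ℕ+ => FinLq q m) p n
        (projLq q n x) (projLq q n y)
      map_smul' := fun c x => lp.single_smul (E := fun m : ℕ+ => FinLq q m) p n c
        (projLq q n x) }
    1 fun x => by
      rw [one_mul]
      refine le_trans (le_of_eq ?_) (norm_projLq_le q hq n x)
      exact lp.norm_single (E := fun m : ℕ+ => FinLq q m) (zero_lt_one.trans_le Fact.out) n _

theorem norm_inclProjLq_le (p q : ℝ≥0∞) [Fact (1 ≤ p)] [Fact (1 ≤ q)] (hq : q ≠ ∞) (n : ℕ+) :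
    ‖inclProjLq p q hq n‖ ≤ 1 :=
  LinearMap.mkContinuous_norm_le _ zero_le_one _

end SequenceSpaces

theorem proposition3p4 (p q : ℝ≥0∞) [Fact (1 ≤ p)] [Fact (1 ≤ q)]
    (hp : 1 < p) (hp' : p < ∞) (hq : 1 < q) (hq' : q < ∞)
    (r : ℝ) (hr : 0 < r)
    (F : SumLpLq p q → ℝ) (hF : UniformlyHSmooth r F) :
    ∃ (φ : ℕ → ℕ+) (G : SeqLq q → ℝ), StrictMono φ ∧
      (∀ x : SeqLq q,
        Tendsto (fun j : ℕ => (F ∘ inclLq p q (φ j) ∘ projLq q (φ j)) x) atTop (𝓝 (G x))) ∧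
      UniformlyHSmooth r G := by
  obtain ⟨k, hk, hFk, M, hM, hFM⟩ := hF
  have := separableSpace_seqLq q hq'.ne
  have hE := equiHolderSmooth_comp hFk (sub_pos.2 hk.1) hM hFM
    (T := fun n : ℕ => inclProjLq p q hq'.ne n.succPNat) fun n => norm_inclProjLq_le p q hq'.ne _
  obtain ⟨ψ, G, hψ, hG⟩ := hE.exists_subseq_tendsto
  -- Convergence along `ψ` is convergence of the whole family along the filter `map ψ atTop`.
  have hG' := hE.contDiff_and_holder_of_tendsto (l := map ψ atTop)
    (fun x => tendsto_map'_iff.2 (hG x))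
  exact ⟨fun j => (ψ j).succPNat, G, fun a b hab => Nat.succPNat_lt_succPNat.2 (hψ hab), hG,
    k, hk, hG'.1, M, hM, hG'.2⟩
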